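/- Consider a game with partial monitoring: finite action sets $\mathcal I$ and $\mathcal J$, a finite set $\mathcal H$ of signals, a payoff function $r:\mathcal I\times\mathcal J\to\mathbb R^d$ and a signaling structure $H:\mathcal I\times\mathcal J\to\Delta(\mathcal H)$, where $\Delta(X)$ denotes the set of probability distributions over a finite set $X$. For $\mathbf p\in\Delta(\mathcal I)$ and $\mathbf q\in\Delta(\mathcal J)$ let $r(\mathbf p,\mathbf q)=\sum_{i,j}p_iq_j\,r(i,j)$ and $\widetilde H(\mathbf q)=\bigl(\sum_{j}q_jH(i,j)\bigr)_{i\in\mathcal I}\in\Delta(\mathcal H)^{\mathcal I}\subset\mathbb R^{\mathcal I\times\mathcal H}$, let $\mathcal F=\{\widetilde H(\mathbf q):\mathbf q\in\Delta(\mathcal J)\}$, and for $\sigma\in\mathcal F$ let $$\overline m(\mathbf p,\sigma)=\bigl\{r(\mathbf p,\mathbf q'):\ \mathbf q'\in\Delta(\mathcal J),\ \widetilde H(\mathbf q')=\sigma\bigr\}\subset\mathbb R^d .$$ For any such game there exist a finite set $\mathcal B\subset\mathcal F$ and an injective piecewise-linear map $\Phi=(\Phi_b)_{b\in\mathcal B}:\mathcal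 F\to\Delta(\mathcal B)$ (that is, $\mathcal F$ is a union of finitely many polytopes, on each of which $\Phi$ coincides with an affine map) such that $$\overline m(\mathbf p,\sigma)=\sum_{b\in\mathcal B}\Phi_b(\sigma)\,\overline m(\mathbf p,b)\qquad\text{for all }\mathbf p\in\Delta(\mathcal I)\text{ and }\sigma\in\mathcal F,$$ where the right-hand side is the Minkowski combination of sets $\bigl\{\sum_b\Phi_b(\sigma)x_b:\ x_b\in\overline m(\mathbf p,b)\text{ for all }b\bigr\}$. Moreover, $\Phi$ is Lipschitz on $\mathcal F$ with respect to the $\ell^2$-norms on $\mathbb R^{\mathcal I\times\mathcal H}$ and $\mathbb R^{\mathcal B}$. -/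

import Mathlib

open scoped Pointwise NNReal

/-- A finite vector-valued game with partial monitoring: action sets `I` (first player) and
`J` (second player), signal set `S`, payoffs `r i j` in Euclidean `ℝ^d`, and laws `H i j` of the
signal, which are probability distributions over `S`. -/
structure PartialMonitoringGame (I J S : Type*) [Fintype S] (d : ℕ) where
  /-- The vector-valued payoff function. -/
  r : I → J → EuclideanSpace ℝ (Fin d)
  /-- The signaling structure. -/
  H : I → J → stdSimplex ℝ S

namespace PartialMonitoringGame

variable {I J S : Type*} [Fintype I] [Fintype J] [Fintype S] {d : ℕ}

/-- The multilinear extension `r(p, q)` of the payoff function to mixed actions. -/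
noncomputable def payoff (G : PartialMonitoringGame I J S d)
    (p : stdSimplex ℝ I) (q : stdSimplex ℝ J) : EuclideanSpace ℝ (Fin d) :=
  ∑ i, ∑ j, ((p : I → ℝ) i * (q : J → ℝ) j) • G.r i j

/-- The vector `H̃(q)` of signal laws: its component of index `i` is the distribution
`∑ j, q j • H i j` over `S`. It is seen as an element of `ℝ^(I × S)` with the `ℓ²` norm. -/
noncomputable def signalMap (G : PartialMonitoringGame I J S d)
    (q : stdSimplex ℝ J) : EuclideanSpace ℝ (I × S) :=
  WithLp.toLp 2 fun x => ∑ j, (q : J → ℝ) j * (G.H x.1 j : S → ℝ) x.2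

/-- The set `F` of feasible vectors of signal laws. -/
def feasible (G : PartialMonitoringGame I J S d) : Set (EuclideanSpace ℝ (I × S)) :=
  Set.range G.signalMap

/-- The set-valued payoff `m̄(p, σ)`: all payoffs compatible with `p` and the signal laws `σ`. -/
def setPayoff (G : PartialMonitoringGame I J S d)
    (p : stdSimplex ℝ I) (σ : EuclideanSpace ℝ (I × S)) : Set (EuclideanSpace ℝ (Fin d)) :=
  {x | ∃ q : stdSimplex ℝ J, G.signalMap q = σ ∧ x = G.payoff p q}

end PartialMonitoringGame

/-- A polytope: the convex hull of a finite set of points. -/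
def IsPolytope {E : Type*} [AddCommGroup E] [Module ℝ E] (P : Set E) : Prop :=
  ∃ V : Set E, V.Finite ∧ P = convexHull ℝ V

/-- A map defined on `X` is piecewise linear if `X` is a union of finitely many polytopes, on each
of which the map coincides with an affine map, i.e. respects convex combinations. (Since
finitely many polytopes have a common polyhedral refinement, it does not matter whether they are
allowed to overlap.) -/
def IsPiecewiseLinear {E V : Type*} [AddCommGroup E] [Module ℝ E] [AddCommGroup V] [Module ℝ V]
    {X : Set E} (f : X → V) : Prop :=
  ∃ D : Set (Set E), D.Finite ∧ (∀ P ∈ D, IsPolytope P) ∧ ⋃₀ D = X ∧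
    ∀ P ∈ D, ∃ A : E →ᵃ[ℝ] V, ∀ x : X, (x : E) ∈ P → f x = A x

/-! ### Simplicial complexes encoded by their barycentric coordinates -/

section BarycentricSystem

variable {E : Type*} [NormedAddCommGroup E] [NormedSpace ℝ E]

/-! Let `T` be the linear extension of the signal map, so that `F` is the image of the simplex
`Δ(J)` under `T`. An extreme point `q` of a fiber of `T` in `Δ(J)` has a support `A` on which `T`
and the total mass are jointly injective; hence `q = L (σ, 1)` for a linear map `L` depending only
on `A`. For fixed `A`, the point `L (σ, 1)` lies in the fiber over `σ` exactly when finitely many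
linear forms in `(σ, 1)` are nonnegative or zero.

Triangulate a region containing `F` so finely that none of these forms changes sign inside a simplex
carrying a point of `F`. The conditions true at `σ` then hold at each vertex `b` of its simplex, so
`L (b, 1)` lies in the fiber over `b` and `q = ∑ Φ σ b • L (b, 1)`. Krein–Milman extends this
splitting from extreme points to whole fibers (`IsBarycentricSystem.exists_decomposition`), and
applying the payoff gives one inclusion; the other is linearity and convexity.

The triangulation starts from one large simplex and is refined by edge subdivisions
(`IsBarycentricSystem.edgeSplit`, `IsBarycentricSystem.exists_insert`). Its coordinates are
functions on the whole space, modified only by linear operations and minima, so they stay Lipschitz.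
-/

/-- The linear map sending a finitely supported weight `μ` on `E` to the pair formed by
`∑ μ b • b` and the total mass `∑ μ b`. -/
noncomputable def homogenize (E : Type*) [NormedAddCommGroup E] [NormedSpace ℝ E] :
    (E →₀ ℝ) →ₗ[ℝ] E × ℝ :=
  Finsupp.linearCombination ℝ fun b => (b, 1)

@[simp]
theorem homogenize_single (b : E) (t : ℝ) : homogenize E (Finsupp.single b t) = (t • b, t) := by
  simp [homogenize]

theorem homogenize_eq_sum (μ : E →₀ ℝ) {B : Finset E} (h : μ.support ⊆ B) :
    homogenize E μ = ∑ b ∈ B, μ b • (b, (1 : ℝ)) := by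
  rw [homogenize, Finsupp.linearCombination_apply]
  exact Finsupp.sum_of_support_subset _ h _ (by simp)

/-- Barycentric coordinates of a simplicial complex with vertices in `B` whose realization
contains `Ω`: every point of `Ω` is the barycenter of its weight `Φ σ`, and any weight carried by
the support of `Φ σ` is the weight of its own barycenter. -/
structure IsBarycentricSystem (Ω : Set E) (B : Finset E) (Φ : E → E →₀ ℝ) : Prop where
  nonneg : ∀ σ ∈ Ω, ∀ b, 0 ≤ Φ σ b
  support_subset : ∀ σ, (Φ σ).support ⊆ B
  homogenize_eq : ∀ σ ∈ Ω, homogenize E (Φ σ) = (σ, 1)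
  eq_of_support_subset : ∀ σ ∈ Ω, ∀ μ : E →₀ ℝ, (∀ b, 0 ≤ μ b) →
    (∀ b, Φ σ b = 0 → μ b = 0) → ∀ y, homogenize E μ = (y, 1) → Φ y = μ
  lipschitz : ∀ b, ∃ K : ℝ≥0, LipschitzWith K fun σ => Φ σ b

/-- No support of a weight `Φ σ` with `σ ∈ Ω` crosses the hyperplane where `f` vanishes. -/
def IsSignCompatible (Ω : Set E) (Φ : E → E →₀ ℝ) (f : E × ℝ →ₗ[ℝ] ℝ) : Prop :=
  ∀ σ ∈ Ω, ∀ a b, Φ σ a ≠ 0 → Φ σ b ≠ 0 → 0 < f (a, 1) → ¬ f (b, 1) < 0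

/-- Effect on weights of the subdivision of the edge `[a, b]` at its point `α • a + β • b`. -/
noncomputable def edgeSplit (a b : E) (α β : ℝ) (w : E →₀ ℝ) : E →₀ ℝ :=
  w - min (w a / α) (w b / β) •
    (Finsupp.single a α + Finsupp.single b β - Finsupp.single (α • a + β • b) 1)

theorem homogenize_edgeSplit (a b : E) {α β : ℝ} (h : α + β = 1) (w : E →₀ ℝ) :
    homogenize E (edgeSplit a b α β w) = homogenize E w := by
  simp [edgeSplit, h]

/-! ### Subdivision of an edge -/

section Split

variable {a b : E} {α β : ℝ}

theorem combo_ne_left (hab : a ≠ b) (hβ : 0 < β) (h : α + β = 1) : α • a + β • b ≠ a := by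
  intro hc
  apply hab
  have h1 : β • (b - a) = 0 := by
    have : α = 1 - β := by linarith
    subst this
    rw [sub_smul, one_smul] at hc
    rw [smul_sub, ← sub_eq_zero.mpr hc]
    abel
  rcases smul_eq_zero.1 h1 with h1 | h1
  · linarith
  · exact (sub_eq_zero.1 h1).symm

theorem combo_ne_right (hab : a ≠ b) (hα : 0 < α) (h : α + β = 1) : α • a + β • b ≠ b := by
  rw [add_comm]
  exact combo_ne_left hab.symm hα (by linarith)

theorem edgeSplit_apply_left (hab : a ≠ b) (hβ : 0 < β) (h : α + β = 1) (w : E →₀ ℝ) :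
    edgeSplit a b α β w a = w a - min (w a / α) (w b / β) * α := by
  have := combo_ne_left hab hβ h
  simp [edgeSplit, hab.symm, this]

theorem edgeSplit_apply_right (hab : a ≠ b) (hα : 0 < α) (h : α + β = 1) (w : E →₀ ℝ) :
    edgeSplit a b α β w b = w b - min (w a / α) (w b / β) * β := by
  have := combo_ne_right hab hα h
  simp [edgeSplit, hab, this]

theorem edgeSplit_apply_mid (hab : a ≠ b) (hα : 0 < α) (hβ : 0 < β) (h : α + β = 1)
    (w : E →₀ ℝ) :
    edgeSplit a b α β w (α • a + β • b) = w (α • a + β • b) + min (w a / α) (w b / β) := by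
  have h1 := combo_ne_left hab hβ h
  have h2 := combo_ne_right hab hα h
  simp [edgeSplit, h1.symm, h2.symm]

theorem edgeSplit_apply_of_ne {x : E} (ha : x ≠ a) (hb : x ≠ b) (hc : x ≠ α • a + β • b)
    (w : E →₀ ℝ) : edgeSplit a b α β w x = w x := by
  simp [edgeSplit, ha.symm, hb.symm, hc.symm]

theorem edgeSplit_nonneg (hab : a ≠ b) (hα : 0 < α) (hβ : 0 < β) (h : α + β = 1)
    {w : E →₀ ℝ} (hw : ∀ x, 0 ≤ w x) (x : E) : 0 ≤ edgeSplit a b α β w x := by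
  by_cases ha : x = a
  · subst ha
    rw [edgeSplit_apply_left hab hβ h, sub_nonneg]
    calc _ ≤ w x / α * α := by gcongr; exact min_le_left _ _
      _ = w x := by field_simp
  by_cases hb : x = b
  · subst hb
    rw [edgeSplit_apply_right hab hα h, sub_nonneg]
    calc _ ≤ w x / β * β := by gcongr; exact min_le_right _ _
      _ = w x := by field_simp
  by_cases hc : x = α • a + β • b
  · subst hc
    rw [edgeSplit_apply_mid hab hα hβ h]
    have := le_min (div_nonneg (hw a) hα.le) (div_nonneg (hw b) hβ.le)
    linarith [hw (α • a + β • b)]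
  · rw [edgeSplit_apply_of_ne ha hb hc]
    exact hw x

/-- The minimum is the multiple of the edge point at which the mass of one endpoint runs out. Thus
no simplex contains the edge any longer. -/
theorem edgeSplit_left_or_right_eq_zero (hab : a ≠ b) (hα : 0 < α) (hβ : 0 < β) (h : α + β = 1)
    (w : E →₀ ℝ) : edgeSplit a b α β w a = 0 ∨ edgeSplit a b α β w b = 0 := by
  rw [edgeSplit_apply_left hab hβ h, edgeSplit_apply_right hab hα h]
  rcases min_choice (w a / α) (w b / β) with h1 | h1
  · left; rw [h1]; field_simp; ring
  · right; rw [h1]; field_simp; ring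

theorem edgeSplit_of_min_eq_zero {w : E →₀ ℝ} (h : min (w a / α) (w b / β) = 0) :
    edgeSplit a b α β w = w := by
  simp [edgeSplit, h]

theorem min_div_eq_zero {ι : Type*} {a b : ι} {α β : ℝ} (hα : 0 < α) (hβ : 0 < β) {w : ι →₀ ℝ}
    (hw : ∀ x, 0 ≤ w x) (h : w a = 0 ∨ w b = 0) : min (w a / α) (w b / β) = 0 := by
  rcases h with h | h
  · rw [h, zero_div]; exact min_eq_left (div_nonneg (hw b) hβ.le)
  · rw [h, zero_div]; exact min_eq_right (div_nonneg (hw a) hα.le)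

theorem edgeSplit_ne_zero (hα : 0 < α) (hβ : 0 < β)
    {w : E →₀ ℝ} (hw : ∀ x, 0 ≤ w x) {x : E} (hx : edgeSplit a b α β w x ≠ 0) :
    w x ≠ 0 ∨ (x = α • a + β • b ∧ w a ≠ 0 ∧ w b ≠ 0) := by
  by_cases h0 : w a = 0 ∨ w b = 0
  · rw [edgeSplit_of_min_eq_zero (min_div_eq_zero hα hβ hw h0)] at hx
    exact Or.inl hx
  push Not at h0
  by_cases hc : x = α • a + β • b
  · exact Or.inr ⟨hc, h0⟩
  left
  by_cases ha : x = a
  · subst ha; exact h0.1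
  by_cases hb : x = b
  · subst hb; exact h0.2
  rwa [edgeSplit_apply_of_ne ha hb hc] at hx

end Split

variable {Ω : Set E} {B : Finset E} {Φ : E → E →₀ ℝ}

/-- Uniqueness is the delicate field: a weight on a new simplex is pushed back to the old one by
returning the mass of the midpoint to the endpoints, and splitting that weight again recovers the
original. -/
theorem IsBarycentricSystem.edgeSplit [DecidableEq E] (hΦ : IsBarycentricSystem Ω B Φ) {a b : E}
    {α β : ℝ} (hab : a ≠ b) (hα : 0 < α) (hβ : 0 < β) (h : α + β = 1) :
    IsBarycentricSystem Ω (B ∪ {a, b, α • a + β • b}) fun σ => edgeSplit a b α β (Φ σ) where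
  nonneg σ hσ := edgeSplit_nonneg hab hα hβ h (hΦ.nonneg σ hσ)
  support_subset σ x hx := by
    by_contra hn
    simp only [Finset.mem_union, Finset.mem_insert, Finset.mem_singleton, not_or] at hn
    rw [Finsupp.mem_support_iff, edgeSplit_apply_of_ne hn.2.1 hn.2.2.1 hn.2.2.2,
      ← Finsupp.mem_support_iff] at hx
    exact hn.1 (hΦ.support_subset σ hx)
  homogenize_eq σ hσ := by rw [homogenize_edgeSplit a b h, hΦ.homogenize_eq σ hσ]
  eq_of_support_subset σ hσ μ hμ hsupp y hy := by
    have hw := hΦ.nonneg σ hσ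
    by_cases h0 : Φ σ a = 0 ∨ Φ σ b = 0
    · have hs : ∀ x, Φ σ x = 0 → μ x = 0 := by
        intro x hx
        apply hsupp
        rwa [edgeSplit_of_min_eq_zero (min_div_eq_zero hα hβ hw h0)]
      rw [hΦ.eq_of_support_subset σ hσ μ hμ hs y hy]
      exact edgeSplit_of_min_eq_zero (min_div_eq_zero hα hβ hμ (h0.imp (hs a) (hs b)))
    push Not at h0
    have hca := combo_ne_left hab hβ h
    have hcb := combo_ne_right hab hα h
    set c := α • a + β • b with hc
    -- If `c` were already a vertex of this simplex, the unit mass at `c` and the combination of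
    -- masses at `a` and `b` would be two weights with barycenter `c`.
    have hcσ : Φ σ c = 0 := by
      by_contra hne
      have h1 := hΦ.eq_of_support_subset σ hσ (Finsupp.single c 1)
        (fun x => by rw [Finsupp.single_apply]; split_ifs <;> norm_num)
        (fun x hx => by
          rw [Finsupp.single_apply, if_neg]
          rintro rfl
          exact hne hx) c (by simp)
      have h2 := hΦ.eq_of_support_subset σ hσ (Finsupp.single a α + Finsupp.single b β)
        (fun x => by
          simp only [Finsupp.add_apply, Finsupp.single_apply]
          split_ifs <;> linarith)
        (fun x hx => by
          have hax : a ≠ x := by rintro rfl; exact h0.1 hx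
          have hbx : b ≠ x := by rintro rfl; exact h0.2 hx
          simp [hax, hbx]) c (by simp [h, hc])
      have h3 := congrArg (fun g : E →₀ ℝ => g a) (h1.symm.trans h2)
      simp [hca, hab.symm] at h3
      exact hα.ne h3
    set w : E →₀ ℝ := μ + μ c • (Finsupp.single a α + Finsupp.single b β - Finsupp.single c 1)
      with hwdef
    have hwa : w a = μ a + μ c * α := by simp [hwdef, hca, hab.symm]
    have hwb : w b = μ b + μ c * β := by simp [hwdef, hcb, hab]
    have hwc : w c = 0 := by simp [hwdef, hca.symm, hcb.symm]
    have hwx : ∀ x, x ≠ a → x ≠ b → x ≠ c → w x = μ x := by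
      intro x h1 h2 h3
      simp [hwdef, h1.symm, h2.symm, h3.symm]
    have hyw : homogenize E w = (y, 1) := by
      rw [← hy]; simp [hwdef, h, hc]
    have hw0 : ∀ x, 0 ≤ w x := by
      intro x
      by_cases h1 : x = a
      · rw [h1, hwa]; have := hμ a; have := hμ c; positivity
      by_cases h2 : x = b
      · rw [h2, hwb]; have := hμ b; have := hμ c; positivity
      by_cases h3 : x = c
      · rw [h3, hwc]
      · rw [hwx x h1 h2 h3]; exact hμ x
    have hsw : ∀ x, Φ σ x = 0 → w x = 0 := by
      intro x hx
      have h1 : x ≠ a := by rintro rfl; exact h0.1 hx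
      have h2 : x ≠ b := by rintro rfl; exact h0.2 hx
      by_cases h3 : x = c
      · rw [h3, hwc]
      · rw [hwx x h1 h2 h3]
        apply hsupp
        rw [edgeSplit_apply_of_ne h1 h2 h3, hx]
    rw [hΦ.eq_of_support_subset σ hσ w hw0 hsw y hyw]
    -- The split weight misses `a` or `b`, hence so does `μ`; the minimum is attained there and
    -- equals the mass returned from `c`.
    have hmin : min (w a / α) (w b / β) = μ c := by
      have ea : w a / α = μ a / α + μ c := by rw [hwa]; field_simp
      have eb : w b / β = μ b / β + μ c := by rw [hwb]; field_simp
      rw [ea, eb]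
      have pa : 0 ≤ μ a / α := div_nonneg (hμ a) hα.le
      have pb : 0 ≤ μ b / β := div_nonneg (hμ b) hβ.le
      rcases edgeSplit_left_or_right_eq_zero hab hα hβ h (Φ σ) with h1 | h1
      · rw [hsupp a h1, zero_div, zero_add]; exact min_eq_left (by linarith)
      · rw [hsupp b h1, zero_div, zero_add]; exact min_eq_right (by linarith)
    rw [_root_.edgeSplit, hmin, hwdef]
    abel
  lipschitz x := by
    obtain ⟨Kx, hx⟩ := hΦ.lipschitz x
    obtain ⟨Ka, ha⟩ := hΦ.lipschitz a
    obtain ⟨Kb, hb⟩ := hΦ.lipschitz b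
    have h1 : LipschitzWith (‖α⁻¹‖₊ * Ka) fun σ => α⁻¹ * Φ σ a :=
      (lipschitzWith_smul (α⁻¹ : ℝ)).comp ha
    have h2 : LipschitzWith (‖β⁻¹‖₊ * Kb) fun σ => β⁻¹ * Φ σ b :=
      (lipschitzWith_smul (β⁻¹ : ℝ)).comp hb
    set k : ℝ := (Finsupp.single a α + Finsupp.single b β - Finsupp.single (α • a + β • b) 1 :
      E →₀ ℝ) x
    have h3 := hx.sub ((lipschitzWith_smul k).comp (h1.min h2))
    refine ⟨Kx + ‖k‖₊ * max (‖α⁻¹‖₊ * Ka) (‖β⁻¹‖₊ * Kb), ?_⟩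
    have heq : ∀ σ, _root_.edgeSplit a b α β (Φ σ) x =
        Φ σ x - k • min (α⁻¹ * Φ σ a) (β⁻¹ * Φ σ b) := fun σ => by
      simp only [_root_.edgeSplit, Finsupp.sub_apply, Finsupp.smul_apply, div_eq_inv_mul,
        smul_eq_mul, k, mul_comm]
    simp only [heq]
    exact h3

/-- The value of `f` at the new vertex is a convex combination of its values at the endpoints, so it
creates no new sign in a simplex. Hence later subdivisions do not spoil forms already treated. -/
theorem IsSignCompatible.edgeSplit {f : E × ℝ →ₗ[ℝ] ℝ} (hf : IsSignCompatible Ω Φ f)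
    (hΦ : IsBarycentricSystem Ω B Φ) {a b : E}
    {α β : ℝ} (hα : 0 < α) (hβ : 0 < β) (h : α + β = 1) :
    IsSignCompatible Ω (fun σ => edgeSplit a b α β (Φ σ)) f := by
  have hfc : f (α • a + β • b, 1) = α * f (a, 1) + β * f (b, 1) := by
    rw [← smul_eq_mul, ← smul_eq_mul, ← map_smul, ← map_smul, ← map_add]
    simp [h]
  intro σ hσ x y hx hy hfx hfy
  have hw := hΦ.nonneg σ hσ
  rcases edgeSplit_ne_zero hα hβ hw hx with h1 | ⟨h1, ha, hb⟩ <;>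
  rcases edgeSplit_ne_zero hα hβ hw hy with h2 | ⟨h2, ha', hb'⟩
  · exact hf σ hσ x y h1 h2 hfx hfy
  · have h3 := not_lt.1 (hf σ hσ x a h1 ha' hfx)
    have h4 := not_lt.1 (hf σ hσ x b h1 hb' hfx)
    rw [h2, hfc] at hfy
    have := mul_nonneg hα.le h3
    have := mul_nonneg hβ.le h4
    linarith
  · rw [h1, hfc] at hfx
    have h3 : f (a, 1) ≤ 0 := not_lt.1 fun h3 => hf σ hσ a y ha h2 h3 hfy
    have h4 : f (b, 1) ≤ 0 := not_lt.1 fun h4 => hf σ hσ b y hb h2 h4 hfy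
    have := mul_nonneg hα.le (neg_nonneg.2 h3)
    have := mul_nonneg hβ.le (neg_nonneg.2 h4)
    linarith
  · rw [h1] at hfx
    rw [h2] at hfy
    linarith

/-- Pairs of vertices of a common simplex which lie strictly on both sides of the zero set
of `f`. -/
def crossingPairs (Ω : Set E) (Φ : E → E →₀ ℝ) (f : E × ℝ →ₗ[ℝ] ℝ) : Set (E × E) :=
  {p | 0 < f (p.1, 1) ∧ f (p.2, 1) < 0 ∧ ∃ σ ∈ Ω, Φ σ p.1 ≠ 0 ∧ Φ σ p.2 ≠ 0}

theorem IsBarycentricSystem.finite_crossingPairs (hΦ : IsBarycentricSystem Ω B Φ)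
    (f : E × ℝ →ₗ[ℝ] ℝ) : (crossingPairs Ω Φ f).Finite := by
  refine (B ×ˢ B).finite_toSet.subset ?_
  rintro p ⟨-, -, σ, -, h1, h2⟩
  rw [Finset.mem_coe, Finset.mem_product]
  exact ⟨hΦ.support_subset σ (Finsupp.mem_support_iff.2 h1),
    hΦ.support_subset σ (Finsupp.mem_support_iff.2 h2)⟩

/-- The new vertex lies on the hyperplane, so it belongs to no crossing pair, while `a` and `b` no
longer share a simplex. -/
theorem crossingPairs_edgeSplit_ssubset (hΦ : IsBarycentricSystem Ω B Φ) {f : E × ℝ →ₗ[ℝ] ℝ}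
    {a b : E} (hp : (a, b) ∈ crossingPairs Ω Φ f) {α β : ℝ} (hα : 0 < α) (hβ : 0 < β)
    (h : α + β = 1) (hf : α * f (a, 1) + β * f (b, 1) = 0) :
    crossingPairs Ω (fun σ => edgeSplit a b α β (Φ σ)) f ⊂ crossingPairs Ω Φ f := by
  have hfc : f (α • a + β • b, 1) = 0 := by
    rw [← hf, ← smul_eq_mul, ← smul_eq_mul, ← map_smul, ← map_smul, ← map_add]
    simp [h]
  have hab : a ≠ b := by
    rintro rfl
    exact lt_asymm hp.1 hp.2.1
  refine (Set.ssubset_iff_of_subset ?_).2 ⟨(a, b), hp, ?_⟩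
  · rintro ⟨x, y⟩ ⟨h1, h2, σ, hσ, hx, hy⟩
    refine ⟨h1, h2, σ, hσ, ?_, ?_⟩
    · rcases edgeSplit_ne_zero hα hβ (hΦ.nonneg σ hσ) hx with h3 | ⟨h3, -⟩
      · exact h3
      · dsimp only at h1 h3
        rw [h3, hfc] at h1
        exact absurd h1 (lt_irrefl _)
    · rcases edgeSplit_ne_zero hα hβ (hΦ.nonneg σ hσ) hy with h3 | ⟨h3, -⟩
      · exact h3
      · dsimp only at h2 h3
        rw [h3, hfc] at h2
        exact absurd h2 (lt_irrefl _)
  · rintro ⟨-, -, σ, -, h1, h2⟩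
    exact (edgeSplit_left_or_right_eq_zero hab hα hβ h (Φ σ)).elim h1 h2

theorem IsBarycentricSystem.exists_insert (f : E × ℝ →ₗ[ℝ] ℝ) (s : Set (E × ℝ →ₗ[ℝ] ℝ)) (n : ℕ) :
    ∀ (B : Finset E) (Φ : E → E →₀ ℝ), IsBarycentricSystem Ω B Φ →
      (∀ g ∈ s, IsSignCompatible Ω Φ g) → (crossingPairs Ω Φ f).ncard = n →
      ∃ B' Φ', IsBarycentricSystem Ω B' Φ' ∧ ∀ g ∈ insert f s, IsSignCompatible Ω Φ' g := by
  classical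
  induction n using Nat.strong_induction_on with
  | _ n ih =>
    intro B Φ hΦ hs hn
    rcases (crossingPairs Ω Φ f).eq_empty_or_nonempty with h0 | ⟨⟨a, b⟩, hp⟩
    · refine ⟨B, Φ, hΦ, ?_⟩
      rintro g (rfl | hg)
      · intro σ hσ a b ha hb h1 h2
        have : (a, b) ∈ crossingPairs Ω Φ g := ⟨h1, h2, σ, hσ, ha, hb⟩
        simp [h0] at this
      · exact hs g hg
    · have ha : 0 < f (a, 1) := hp.1
      have hb : f (b, 1) < 0 := hp.2.1
      have hab : a ≠ b := by
        rintro rfl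
        exact lt_asymm ha hb
      have hD : 0 < f (a, 1) - f (b, 1) := by linarith
      -- These coefficients locate the zero of `f` on the edge from `a` to `b`.
      have hα : 0 < -f (b, 1) / (f (a, 1) - f (b, 1)) := div_pos (by linarith) hD
      have hβ : 0 < f (a, 1) / (f (a, 1) - f (b, 1)) := div_pos ha hD
      have h : -f (b, 1) / (f (a, 1) - f (b, 1)) + f (a, 1) / (f (a, 1) - f (b, 1)) = 1 := by
        field_simp; ring
      have hf : -f (b, 1) / (f (a, 1) - f (b, 1)) * f (a, 1) +
          f (a, 1) / (f (a, 1) - f (b, 1)) * f (b, 1) = 0 := by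
        field_simp; ring
      have hlt := Set.ncard_lt_ncard (crossingPairs_edgeSplit_ssubset hΦ hp hα hβ h hf)
        (hΦ.finite_crossingPairs f)
      rw [hn] at hlt
      exact ih _ hlt _ _ (hΦ.edgeSplit hab hα hβ h) (fun g hg => (hs g hg).edgeSplit hΦ hα hβ h)
        rfl

theorem IsBarycentricSystem.exists_isSignCompatible (hΦ : IsBarycentricSystem Ω B Φ)
    {s : Set (E × ℝ →ₗ[ℝ] ℝ)} (hs : s.Finite) :
    ∃ B' Φ', IsBarycentricSystem Ω B' Φ' ∧ ∀ g ∈ s, IsSignCompatible Ω Φ' g := by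
  induction s, hs using Set.Finite.induction_on with
  | empty => exact ⟨B, Φ, hΦ, by simp⟩
  | @insert f s _ _ ih =>
    obtain ⟨B', Φ', h1, h2⟩ := ih
    exact IsBarycentricSystem.exists_insert f s _ B' Φ' h1 h2 rfl

theorem IsBarycentricSystem.apply_eq_sum (hΦ : IsBarycentricSystem Ω B Φ) {V : Type*}
    [AddCommGroup V] [Module ℝ V] (f : E × ℝ →ₗ[ℝ] V) {σ : E} (hσ : σ ∈ Ω) :
    f (σ, 1) = ∑ b ∈ B, Φ σ b • f (b, 1) := by
  rw [← hΦ.homogenize_eq σ hσ, homogenize_eq_sum _ (hΦ.support_subset σ), map_sum]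
  simp only [map_smul]

/-- One negative vertex would force `f ≤ 0` at all vertices of the simplex, making the average `f
(σ, 1)` negative. -/
theorem IsSignCompatible.nonneg {f : E × ℝ →ₗ[ℝ] ℝ} (hf : IsSignCompatible Ω Φ f)
    (hΦ : IsBarycentricSystem Ω B Φ) {σ : E} (hσ : σ ∈ Ω) (h : 0 ≤ f (σ, 1)) {b : E}
    (hb : Φ σ b ≠ 0) : 0 ≤ f (b, 1) := by
  by_contra! hlt
  have hle : ∀ a ∈ B, Φ σ a • f (a, 1) ≤ 0 := by
    intro a _
    by_cases ha : Φ σ a = 0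
    · simp [ha]
    · have : f (a, 1) ≤ 0 := not_lt.1 fun h3 => hf σ hσ a b ha hb h3 hlt
      exact mul_nonpos_of_nonneg_of_nonpos (hΦ.nonneg σ hσ a) this
  have hbpos : 0 < Φ σ b := lt_of_le_of_ne (hΦ.nonneg σ hσ b) hb.symm
  have := Finset.sum_lt_sum hle ⟨b, hΦ.support_subset σ (Finsupp.mem_support_iff.2 hb),
    mul_neg_of_pos_of_neg hbpos hlt⟩
  rw [← hΦ.apply_eq_sum f hσ, Finset.sum_const_zero] at this
  linarith

theorem IsSignCompatible.neg {f : E × ℝ →ₗ[ℝ] ℝ} (hf : IsSignCompatible Ω Φ f) :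
    IsSignCompatible Ω Φ (-f) := by
  intro σ hσ a b ha hb h1 h2
  simp only [LinearMap.neg_apply] at h1 h2
  exact hf σ hσ b a hb ha (by linarith) (by linarith)

theorem IsSignCompatible.eq_zero {f : E × ℝ →ₗ[ℝ] ℝ} (hf : IsSignCompatible Ω Φ f)
    (hΦ : IsBarycentricSystem Ω B Φ) {σ : E} (hσ : σ ∈ Ω) (h : f (σ, 1) = 0) {b : E}
    (hb : Φ σ b ≠ 0) : f (b, 1) = 0 := by
  have h1 := hf.nonneg hΦ hσ h.ge hb
  have h2 := hf.neg.nonneg hΦ hσ (by simp [h]) hb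
  simp only [LinearMap.neg_apply] at h2
  linarith

end BarycentricSystem

/-! ### Affine structure on the cells, and the initial simplex -/

section Cells

/-- A positive function on a finite set dominates a small multiple of any other function. -/
theorem Finset.exists_pos_mul_abs_le {ι : Type*} (s : Finset ι) (w z : ι → ℝ)
    (hw : ∀ i ∈ s, 0 < w i) : ∃ t : ℝ, 0 < t ∧ ∀ i ∈ s, t * |z i| ≤ w i := by
  classical
  induction s using Finset.induction_on with
  | empty => exact ⟨1, one_pos, by simp⟩
  | insert a s _ ih =>
    obtain ⟨t, ht, h⟩ := ih fun i hi => hw i (Finset.mem_insert_of_mem hi)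
    have ha := hw a (Finset.mem_insert_self a s)
    have hp : 0 < |z a| + 1 := by positivity
    refine ⟨min t (w a / (|z a| + 1)), lt_min ht (div_pos ha hp), ?_⟩
    intro i hi
    rcases Finset.mem_insert.1 hi with rfl | hi
    · calc _ ≤ w i / (|z i| + 1) * |z i| := by gcongr; exact min_le_right _ _
        _ ≤ w i / (|z i| + 1) * (|z i| + 1) := by gcongr; linarith
        _ = w i := by field_simp
    · calc _ ≤ t * |z i| := by gcongr; exact min_le_left _ _
        _ ≤ w i := h i hi

variable {E : Type*} [NormedAddCommGroup E] [NormedSpace ℝ E]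
variable {Ω : Set E} {B : Finset E} {Φ : E → E →₀ ℝ}

/-- This is affine independence of the vertices of a simplex: adding a small multiple of `μ` to `Φ
σ` keeps it nonnegative with the same barycenter, contradicting uniqueness unless `μ = 0`. -/
theorem IsBarycentricSystem.eq_zero_of_homogenize_eq_zero (hΦ : IsBarycentricSystem Ω B Φ)
    {σ : E} (hσ : σ ∈ Ω) {μ : E →₀ ℝ} (hμ : ∀ b, Φ σ b = 0 → μ b = 0)
    (h : homogenize E μ = 0) : μ = 0 := by
  obtain ⟨t, ht, hle⟩ := (Φ σ).support.exists_pos_mul_abs_le (Φ σ) μ fun b hb =>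
    lt_of_le_of_ne (hΦ.nonneg σ hσ b) (Finsupp.mem_support_iff.1 hb).symm
  have h1 : Φ σ = Φ σ + t • μ := by
    refine hΦ.eq_of_support_subset σ hσ _ ?_ ?_ σ ?_
    · intro b
      rw [Finsupp.add_apply, Finsupp.smul_apply, smul_eq_mul]
      by_cases hb : Φ σ b = 0
      · simp [hb, hμ b hb]
      · have h2 := hle b (Finsupp.mem_support_iff.2 hb)
        have h3 : t * -|μ b| ≤ t * μ b := by gcongr; exact neg_abs_le _
        linarith
    · intro b hb
      simp [hb, hμ b hb]
    · simp [h, hΦ.homogenize_eq σ hσ]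
  have h2 : t • μ = 0 := by simpa using h1
  exact (smul_eq_zero.1 h2).resolve_left ht.ne'

theorem IsBarycentricSystem.exists_affineMap (hΦ : IsBarycentricSystem Ω B Φ) {σ : E}
    (hσ : σ ∈ Ω) : ∃ L : E × ℝ →ₗ[ℝ] (E →₀ ℝ),
      ∀ y ∈ convexHull ℝ ((Φ σ).support : Set E), Φ y = L (y, 1) := by
  obtain ⟨L, hL⟩ := LinearMap.exists_leftInverse_of_injective (K := ℝ)
    (V := Finsupp.supported ℝ ℝ ((Φ σ).support : Set E)) (V' := E × ℝ)
    ((homogenize E).comp (Finsupp.supported ℝ ℝ ((Φ σ).support : Set E)).subtype) (by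
      rw [LinearMap.ker_eq_bot']
      rintro ⟨μ, hμ⟩ h
      refine Subtype.ext (hΦ.eq_zero_of_homogenize_eq_zero hσ (fun b hb => ?_) h)
      exact (Finsupp.mem_supported' ℝ μ).1 hμ b (by simpa using hb))
  refine ⟨(Finsupp.supported ℝ ℝ ((Φ σ).support : Set E)).subtype.comp L, fun y hy => ?_⟩
  obtain ⟨w, hw0, hw1, hwy⟩ := Finset.mem_convexHull'.1 hy
  have hsupp : ∀ b, b ∉ (Φ σ).support → Finsupp.indicator (Φ σ).support (fun b _ => w b) b = 0 :=
    fun b hb => Finsupp.indicator_of_notMem hb _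
  have hhom : homogenize E (Finsupp.indicator (Φ σ).support fun b _ => w b) = (y, 1) := by
    rw [homogenize_eq_sum _ (Finsupp.support_indicator_subset _ _),
      Finset.sum_congr rfl fun b hb => by rw [Finsupp.indicator_of_mem hb]]
    exact Prod.ext (by simpa [Prod.fst_sum] using hwy) (by simpa [Prod.snd_sum] using hw1)
  have hmem : Finsupp.indicator (Φ σ).support (fun b _ => w b) ∈
      Finsupp.supported ℝ ℝ ((Φ σ).support : Set E) := by
    rw [Finsupp.mem_supported']
    exact fun b hb => hsupp b (by simpa using hb)
  rw [hΦ.eq_of_support_subset σ hσ _ (fun b => ?_) (fun b hb => hsupp b (by simpa using hb)) y hhom]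
  · have := LinearMap.congr_fun hL ⟨_, hmem⟩
    simp only [LinearMap.comp_apply, Submodule.subtype_apply, LinearMap.id_apply, hhom] at this
    rw [LinearMap.comp_apply, this]
    rfl
  · by_cases hb : b ∈ (Φ σ).support
    · rw [Finsupp.indicator_of_mem hb]
      exact hw0 b hb
    · rw [hsupp b hb]

/-- The linear extension to `ℝ^ι × ℝ` of the barycentric coordinates of `ℝ^ι` (at height `1`) with
respect to the simplex with vertices `0` and `M • e i`. -/
noncomputable def cornerCoordinates {ι : Type*} [Fintype ι] [DecidableEq ι] (M : ℝ) :
    EuclideanSpace ℝ ι × ℝ →ₗ[ℝ] (EuclideanSpace ℝ ι →₀ ℝ) where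
  toFun z := Finsupp.single 0 (z.2 - ∑ i, z.1 i / M) +
    ∑ i, Finsupp.single (EuclideanSpace.single i M) (z.1 i / M)
  map_add' z z' := by
    have : z.2 + z'.2 - ∑ i, (z.1 i + z'.1 i) / M =
        (z.2 - ∑ i, z.1 i / M) + (z'.2 - ∑ i, z'.1 i / M) := by
      simp only [add_div, Finset.sum_add_distrib]
      ring
    simp only [Prod.fst_add, Prod.snd_add, PiLp.add_apply, this]
    simp only [add_div, Finsupp.single_add, Finset.sum_add_distrib]
    abel
  map_smul' t z := by
    have : t * z.2 - ∑ i, t * z.1 i / M = t * (z.2 - ∑ i, z.1 i / M) := by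
      simp only [mul_div_assoc, ← Finset.mul_sum]
      ring
    simp only [Prod.smul_fst, Prod.smul_snd, PiLp.smul_apply, smul_eq_mul, this]
    simp only [smul_add, Finset.smul_sum, Finsupp.smul_single, smul_eq_mul, RingHom.id_apply,
      mul_div_assoc]

theorem cornerCoordinates_apply {ι : Type*} [Fintype ι] [DecidableEq ι] (M : ℝ)
    (z : EuclideanSpace ℝ ι × ℝ) :
    cornerCoordinates M z = Finsupp.single 0 (z.2 - ∑ i, z.1 i / M) +
      ∑ i, Finsupp.single (EuclideanSpace.single i M) (z.1 i / M) :=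
  rfl

/-- Uniqueness holds because `cornerCoordinates M` is linear and sends each vertex to its own unit
mass, so it inverts `homogenize` on weights carried by the vertices. -/
theorem isBarycentricSystem_cornerCoordinates {ι : Type*} [Fintype ι] [DecidableEq ι] {M : ℝ}
    (hM : 0 < M) {Ω : Set (EuclideanSpace ℝ ι)} (h0 : ∀ σ ∈ Ω, ∀ i, 0 ≤ σ i)
    (h1 : ∀ σ ∈ Ω, ∑ i, σ i ≤ M) :
    IsBarycentricSystem Ω (insert 0 (Finset.univ.image fun i => EuclideanSpace.single i M))
      fun σ => cornerCoordinates M (σ, 1) := by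
  have hsupp : ∀ σ : EuclideanSpace ℝ ι, (cornerCoordinates M (σ, 1)).support ⊆
      insert 0 (Finset.univ.image fun i => EuclideanSpace.single i M) := by
    intro σ b hb
    contrapose! hb
    simp only [Finset.mem_insert, Finset.mem_image, Finset.mem_univ, true_and, not_or,
      not_exists] at hb
    rw [Finsupp.mem_support_iff, not_not, cornerCoordinates_apply,
      Finsupp.add_apply, Finsupp.finsetSum_apply, Finsupp.single_eq_of_ne hb.1, zero_add]
    exact Finset.sum_eq_zero fun i _ => Finsupp.single_eq_of_ne (Ne.symm (hb.2 i))
  refine ⟨fun σ hσ b => ?_, hsupp, fun σ hσ => ?_, fun σ hσ μ _ hs y hy => ?_, fun b => ?_⟩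
  · rw [cornerCoordinates_apply, Finsupp.add_apply,
      Finsupp.finsetSum_apply]
    refine add_nonneg ?_ (Finset.sum_nonneg fun i _ => ?_)
    · rw [Finsupp.single_apply]
      split_ifs
      · rw [← Finset.sum_div, sub_nonneg, div_le_one hM]
        exact h1 σ hσ
      · exact le_rfl
    · rw [Finsupp.single_apply]
      split_ifs
      · exact div_nonneg (h0 σ hσ i) hM.le
      · exact le_rfl
  · rw [cornerCoordinates_apply, map_add, map_sum]
    simp only [homogenize_single, smul_zero]
    refine Prod.ext ?_ ?_
    · ext j
      simp [Prod.fst_sum, Finset.sum_apply, Pi.single_apply, hM.ne']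
    · simp [Prod.snd_sum]
  · rw [← hy]
    have hb : ∀ b ∈ insert 0 (Finset.univ.image fun i : ι => EuclideanSpace.single i M),
        cornerCoordinates M (b, (1 : ℝ)) = Finsupp.single b 1 := by
      intro b hb
      rcases Finset.mem_insert.1 hb with rfl | hb
      · simp [cornerCoordinates_apply]
      · obtain ⟨i, -, rfl⟩ := Finset.mem_image.1 hb
        have h2 : ∀ j, (EuclideanSpace.single i M : EuclideanSpace ℝ ι) j / M =
            if j = i then 1 else 0 := by
          intro j
          by_cases h : j = i
          · simp [h, hM.ne']
          · simp [h]
        simp only [cornerCoordinates_apply, h2, Finset.sum_ite_eq',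
          Finset.mem_univ, if_true, sub_self, Finsupp.single_zero, zero_add]
        rw [Finset.sum_eq_single i]
        · simp
        · intro j _ hj
          simp [hj]
        · simp
    have hμ : μ.support ⊆ insert 0 (Finset.univ.image fun i => EuclideanSpace.single i M) := by
      intro b hb
      refine hsupp σ (Finsupp.mem_support_iff.2 fun h => ?_)
      exact Finsupp.mem_support_iff.1 hb (hs b h)
    rw [homogenize_eq_sum μ hμ, map_sum (cornerCoordinates M)]
    conv_rhs => rw [← Finsupp.sum_single μ, Finsupp.sum_of_support_subset _ hμ _ (by simp)]
    refine Finset.sum_congr rfl fun b hbm => ?_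
    rw [map_smul, hb b hbm, Finsupp.smul_single, smul_eq_mul, mul_one]
  · have h2 := ((Finsupp.lapply b ∘ₗ cornerCoordinates M ∘ₗ
      LinearMap.inl ℝ (EuclideanSpace ℝ ι) ℝ).toContinuousLinearMap.lipschitz).add
      (LipschitzWith.const (cornerCoordinates M ((0 : EuclideanSpace ℝ ι), (1 : ℝ)) b))
    have heq : ∀ σ : EuclideanSpace ℝ ι, cornerCoordinates M (σ, (1 : ℝ)) b =
        cornerCoordinates M (σ, (0 : ℝ)) b +
          cornerCoordinates M ((0 : EuclideanSpace ℝ ι), (1 : ℝ)) b := fun σ => by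
      rw [← Finsupp.add_apply, ← map_add]
      simp
    obtain ⟨K, hK⟩ : ∃ K, LipschitzWith K fun σ : EuclideanSpace ℝ ι =>
        cornerCoordinates M (σ, (0 : ℝ)) b +
          cornerCoordinates M ((0 : EuclideanSpace ℝ ι), (1 : ℝ)) b := ⟨_, h2⟩
    refine ⟨K, fun x y => ?_⟩
    dsimp only
    rw [heq x, heq y]
    exact hK x y

end Cells

/-! ### Fibers of a linear map on the standard simplex -/

section Fibers

variable {J : Type*} [Fintype J] {E : Type*} [NormedAddCommGroup E] [NormedSpace ℝ E]

/-- The points of the standard simplex which `T` sends to `σ`. -/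
def simplexFiber (T : (J → ℝ) →ₗ[ℝ] E) (σ : E) : Set (J → ℝ) :=
  {q | q ∈ stdSimplex ℝ J ∧ T q = σ}

theorem convex_simplexFiber (T : (J → ℝ) →ₗ[ℝ] E) (σ : E) : Convex ℝ (simplexFiber T σ) :=
  (convex_stdSimplex ℝ J).inter ((convex_singleton σ).linear_preimage T)

theorem isCompact_simplexFiber (T : (J → ℝ) →ₗ[ℝ] E) (σ : E) : IsCompact (simplexFiber T σ) :=
  (isCompact_stdSimplex ℝ J).inter_right
    (isClosed_singleton.preimage (LinearMap.continuous_of_finiteDimensional T))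

/-- Extreme points of a fiber have supports on which `T`, together with the total mass, is
injective. -/
theorem eq_zero_of_mem_extremePoints {T : (J → ℝ) →ₗ[ℝ] E} {σ : E} {q : J → ℝ}
    (hq : q ∈ (simplexFiber T σ).extremePoints ℝ) {z : J → ℝ} (hz : ∀ j, q j = 0 → z j = 0)
    (hT : T z = 0) (hsum : ∑ j, z j = 0) : z = 0 := by
  classical
  obtain ⟨⟨⟨hq0, hq1⟩, hqσ⟩, hext⟩ := hq
  obtain ⟨t, ht, hle⟩ := (Finset.univ.filter fun j => q j ≠ 0).exists_pos_mul_abs_le q z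
    fun j hj => lt_of_le_of_ne (hq0 j) (Finset.mem_filter.1 hj).2.symm
  have hmem : ∀ s : ℝ, |s| = t → q + s • z ∈ simplexFiber T σ := by
    intro s hs
    refine ⟨⟨fun j => ?_, ?_⟩, by simp [hT, hqσ]⟩
    · by_cases hj : q j = 0
      · simp [hj, hz j hj]
      · have h1 := hle j (by simp [hj])
        have h2 := neg_abs_le (s * z j)
        rw [abs_mul, hs] at h2
        simp only [Pi.add_apply, Pi.smul_apply, smul_eq_mul]
        linarith
    · simp [Finset.sum_add_distrib, ← Finset.mul_sum, hsum, hq1]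
  -- The extreme point `q` is the midpoint of `q + t • z` and `q - t • z`.
  have h := hext (hmem t (abs_of_pos ht)) (hmem (-t) (by rw [abs_neg, abs_of_pos ht]))
    ⟨1 / 2, 1 / 2, by norm_num, by norm_num, by norm_num, by module⟩
  have h2 : t • z = 0 := by simpa using h
  exact (smul_eq_zero.1 h2).resolve_left ht.ne'

/-- The linear map recording the image under `T` and the total mass. -/
def massMap (T : (J → ℝ) →ₗ[ℝ] E) : (J → ℝ) →ₗ[ℝ] E × ℝ :=
  T.prod (∑ j, LinearMap.proj j)

theorem massMap_apply (T : (J → ℝ) →ₗ[ℝ] E) (q : J → ℝ) : massMap T q = (T q, ∑ j, q j) := by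
  simp [massMap]

/-- Injectivity is assumed inside the existential, with `0` as default, so that one inverse can be
chosen for every `A` at once. -/
theorem exists_inverse_on_support (T : (J → ℝ) →ₗ[ℝ] E) (A : Set J) :
    ∃ L : E × ℝ →ₗ[ℝ] (J → ℝ), (∀ z : J → ℝ, (∀ j ∉ A, z j = 0) → massMap T z = 0 → z = 0) →
      ∀ q : J → ℝ, (∀ j ∉ A, q j = 0) → L (massMap T q) = q := by
  by_cases h : ∀ z : J → ℝ, (∀ j ∉ A, z j = 0) → massMap T z = 0 → z = 0
  · let W : Submodule ℝ (J → ℝ) :=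
      { carrier := {z | ∀ j ∉ A, z j = 0}
        add_mem' := fun ha hb j hj => by simp [ha j hj, hb j hj]
        zero_mem' := fun j _ => rfl
        smul_mem' := fun c z hz j hj => by simp [hz j hj] }
    obtain ⟨L, hL⟩ := LinearMap.exists_leftInverse_of_injective (K := ℝ) (V := W) (V' := E × ℝ)
      ((massMap T).comp W.subtype) (by
        rw [LinearMap.ker_eq_bot']
        rintro ⟨z, hz⟩ h1
        exact Subtype.ext (h z hz h1))
    refine ⟨W.subtype.comp L, fun _ q hq => ?_⟩
    exact congrArg Subtype.val (LinearMap.congr_fun hL ⟨q, hq⟩)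
  · exact ⟨0, fun h' => absurd h' h⟩

/-- If the supports of a barycentric system do not cross any of the hyperplanes bounding the images
of the simplices on which `T` is injective, then fibers of `T` decompose along the system. -/
theorem exists_isBarycentricSystem_simplexFiber {ι : Type*} [Fintype ι]
    (T : (J → ℝ) →ₗ[ℝ] EuclideanSpace ℝ ι) {B₀ : Finset (EuclideanSpace ℝ ι)}
    {Φ₀ : EuclideanSpace ℝ ι → EuclideanSpace ℝ ι →₀ ℝ}
    (h₀ : IsBarycentricSystem (T '' stdSimplex ℝ J) B₀ Φ₀) :
    ∃ B Φ, IsBarycentricSystem (T '' stdSimplex ℝ J) B Φ ∧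
      ∀ σ, ∀ q ∈ (simplexFiber T σ).extremePoints ℝ,
        ∃ L : EuclideanSpace ℝ ι × ℝ →ₗ[ℝ] (J → ℝ), L (σ, 1) = q ∧
          ∀ b, Φ σ b ≠ 0 → L (b, 1) ∈ simplexFiber T b := by
  classical
  choose L hL using exists_inverse_on_support T
  -- The three families express membership of `L A (σ, 1)` in the fiber: nonnegative coordinates,
  -- image `σ`, and total mass `1`.
  let fJ : Set J × J → (EuclideanSpace ℝ ι × ℝ →ₗ[ℝ] ℝ) := fun p => LinearMap.proj p.2 ∘ₗ L p.1
  let fT : Set J × ι → (EuclideanSpace ℝ ι × ℝ →ₗ[ℝ] ℝ) := fun p =>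
    (EuclideanSpace.proj p.2 : EuclideanSpace ℝ ι →L[ℝ] ℝ).toLinearMap ∘ₗ
      (LinearMap.fst ℝ _ ℝ - T ∘ₗ L p.1)
  let fS : Set J → (EuclideanSpace ℝ ι × ℝ →ₗ[ℝ] ℝ) := fun A =>
    LinearMap.snd ℝ _ ℝ - (∑ j, LinearMap.proj j) ∘ₗ L A
  obtain ⟨B, Φ, hΦ, hs⟩ := h₀.exists_isSignCompatible
    (((Set.finite_range fJ).union (Set.finite_range fT)).union (Set.finite_range fS))
  refine ⟨B, Φ, hΦ, fun σ q hq => ?_⟩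
  have hqσ : q ∈ stdSimplex ℝ J ∧ T q = σ := hq.1
  have hσ : σ ∈ T '' stdSimplex ℝ J := ⟨q, hqσ⟩
  have hLq : L {j | q j ≠ 0} (σ, 1) = q := by
    have := hL {j | q j ≠ 0} (fun z hz h => ?_) q (fun j hj => by simpa using hj)
    · rwa [massMap_apply, hqσ.2, hqσ.1.2] at this
    · rw [massMap_apply, Prod.mk_eq_zero] at h
      exact eq_zero_of_mem_extremePoints hq (fun j hj => hz j (by simpa using hj)) h.1 h.2
  refine ⟨L {j | q j ≠ 0}, hLq, fun b hb => ⟨⟨fun j => ?_, ?_⟩, ?_⟩⟩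
  · refine (hs (fJ ({j | q j ≠ 0}, j)) (Or.inl (Or.inl ⟨_, rfl⟩))).nonneg hΦ hσ ?_ hb
    simp only [fJ, LinearMap.comp_apply, LinearMap.proj_apply, hLq]
    exact hqσ.1.1 j
  · have := (hs (fS {j | q j ≠ 0}) (Or.inr ⟨_, rfl⟩)).eq_zero hΦ hσ (by simp [fS, hLq, hqσ.1.2]) hb
    simp only [fS, LinearMap.sub_apply, LinearMap.snd_apply, LinearMap.comp_apply,
      LinearMap.sum_apply, LinearMap.proj_apply] at this
    linarith
  · ext i
    have := (hs (fT ({j | q j ≠ 0}, i)) (Or.inl (Or.inr ⟨_, rfl⟩))).eq_zero hΦ hσ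
      (by simp [fT, hLq, hqσ.2]) hb
    simp [fT] at this
    linarith

/-- The weighted sum of fibers is compact and convex and contains the extreme points of the fiber
over `σ`, hence the whole fiber by Krein–Milman. -/
theorem IsBarycentricSystem.exists_decomposition {B : Finset E} {Φ : E → E →₀ ℝ}
    {T : (J → ℝ) →ₗ[ℝ] E} (hΦ : IsBarycentricSystem (T '' stdSimplex ℝ J) B Φ)
    (h : ∀ σ, ∀ q ∈ (simplexFiber T σ).extremePoints ℝ, ∃ L : E × ℝ →ₗ[ℝ] (J → ℝ),
      L (σ, 1) = q ∧ ∀ b, Φ σ b ≠ 0 → L (b, 1) ∈ simplexFiber T b)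
    {σ : E} {q : J → ℝ} (hq : q ∈ simplexFiber T σ) :
    ∃ x : E → J → ℝ, (∀ b, Φ σ b ≠ 0 → x b ∈ simplexFiber T b) ∧ ∑ b ∈ B, Φ σ b • x b = q := by
  classical
  let g : (B → J → ℝ) →ₗ[ℝ] (J → ℝ) := ∑ b : B, Φ σ b • LinearMap.proj b
  have hg : ∀ x, g x = ∑ b : B, Φ σ b • x b := fun x => by simp [g]
  -- A vertex of weight zero may lie outside the image of `T`, where the fiber is empty; `{0}` keeps
  -- the product usable.
  let s : B → Set (J → ℝ) := fun b => if Φ σ b = 0 then {0} else simplexFiber T b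
  have hconv : Convex ℝ (g '' Set.univ.pi s) := by
    refine (convex_pi fun b _ => ?_).linear_image g
    simp only [s]
    split_ifs
    · exact convex_singleton 0
    · exact convex_simplexFiber T b
  have hcomp : IsCompact (g '' Set.univ.pi s) := by
    refine (isCompact_univ_pi fun b => ?_).image (LinearMap.continuous_of_finiteDimensional g)
    simp only [s]
    split_ifs
    · exact isCompact_singleton
    · exact isCompact_simplexFiber T b
  have hext : (simplexFiber T σ).extremePoints ℝ ⊆ g '' Set.univ.pi s := by
    intro y hy
    obtain ⟨L, hL, hLb⟩ := h σ y hy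
    refine ⟨fun b => if Φ σ b = 0 then 0 else L (b, 1), fun b _ => ?_, ?_⟩
    · simp only [s]
      split_ifs with hb
      · rfl
      · exact hLb b hb
    · rw [hg, ← hL, hΦ.apply_eq_sum L ⟨y, hy.1⟩, ← Finset.sum_coe_sort B]
      refine Finset.sum_congr rfl fun b _ => ?_
      split_ifs with hb
      · simp [hb]
      · rfl
  have hsub := closure_minimal (convexHull_min hext hconv) hcomp.isClosed
  rw [closure_convexHull_extremePoints (isCompact_simplexFiber T σ)
    (convex_simplexFiber T σ)] at hsub
  obtain ⟨x, hx, hxq⟩ := hsub hq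
  refine ⟨fun b => if hb : b ∈ B then x ⟨b, hb⟩ else 0, fun b hb => ?_, ?_⟩
  · have hbB : b ∈ B := hΦ.support_subset σ (Finsupp.mem_support_iff.2 hb)
    have := hx ⟨b, hbB⟩ trivial
    simpa [s, hb, hbB] using this
  · rw [← hxq, hg, ← Finset.sum_coe_sort B]
    simp

theorem mem_image_stdSimplex_of_ne_zero {Φ : E → E →₀ ℝ} {T : (J → ℝ) →ₗ[ℝ] E}
    (h : ∀ σ, ∀ q ∈ (simplexFiber T σ).extremePoints ℝ, ∃ L : E × ℝ →ₗ[ℝ] (J → ℝ),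
      L (σ, 1) = q ∧ ∀ b, Φ σ b ≠ 0 → L (b, 1) ∈ simplexFiber T b)
    {σ : E} (hσ : σ ∈ T '' stdSimplex ℝ J) {b : E} (hb : Φ σ b ≠ 0) :
    b ∈ T '' stdSimplex ℝ J := by
  obtain ⟨q, hq⟩ := (isCompact_simplexFiber T σ).extremePoints_nonempty hσ
  obtain ⟨L, -, hL⟩ := h σ q hq
  exact ⟨_, hL b hb⟩

end Fibers

/-! ### Passage to a map into the simplex of vertices -/

section Restriction

variable {E : Type*} [NormedAddCommGroup E] [NormedSpace ℝ E]
variable {Ω : Set E} {B C : Finset E} {Φ : E → E →₀ ℝ}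

theorem IsBarycentricSystem.sum_smul_eq (hΦ : IsBarycentricSystem Ω B Φ) {σ : E} (hσ : σ ∈ Ω)
    (hC : (Φ σ).support ⊆ C) : ∑ b ∈ C, Φ σ b • b = σ := by
  have h := hΦ.homogenize_eq σ hσ
  rw [homogenize_eq_sum _ hC] at h
  have h2 := congrArg Prod.fst h
  rw [Prod.fst_sum] at h2
  simpa using h2

theorem IsBarycentricSystem.sum_eq_one (hΦ : IsBarycentricSystem Ω B Φ) {σ : E} (hσ : σ ∈ Ω)
    (hC : (Φ σ).support ⊆ C) : ∑ b ∈ C, Φ σ b = 1 := by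
  have h := hΦ.homogenize_eq σ hσ
  rw [homogenize_eq_sum _ hC] at h
  have h2 := congrArg Prod.snd h
  rw [Prod.snd_sum] at h2
  simpa using h2

/-- The weights of a barycentric system, as points of the standard simplex over a set of vertices
that contains their supports. -/
def IsBarycentricSystem.toStdSimplex (hΦ : IsBarycentricSystem Ω B Φ)
    (hC : ∀ σ ∈ Ω, (Φ σ).support ⊆ C) (σ : Ω) : stdSimplex ℝ C :=
  ⟨fun b => Φ σ b, fun b => hΦ.nonneg σ σ.2 b,
    (Finset.sum_coe_sort C fun b => Φ σ b).trans (hΦ.sum_eq_one σ.2 (hC σ σ.2))⟩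

theorem IsBarycentricSystem.toStdSimplex_apply (hΦ : IsBarycentricSystem Ω B Φ)
    (hC : ∀ σ ∈ Ω, (Φ σ).support ⊆ C) (σ : Ω) (b : C) :
    (hΦ.toStdSimplex hC σ : C → ℝ) b = Φ σ b :=
  rfl

/-- A point is recovered from its weights as their barycenter. -/
theorem IsBarycentricSystem.toStdSimplex_injective (hΦ : IsBarycentricSystem Ω B Φ)
    (hC : ∀ σ ∈ Ω, (Φ σ).support ⊆ C) : Function.Injective (hΦ.toStdSimplex hC) := by
  intro σ τ h
  apply Subtype.ext
  rw [← hΦ.sum_smul_eq σ.2 (hC σ σ.2), ← hΦ.sum_smul_eq τ.2 (hC τ τ.2)]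
  refine Finset.sum_congr rfl fun b hb => ?_
  rw [← hΦ.toStdSimplex_apply hC σ ⟨b, hb⟩, h, hΦ.toStdSimplex_apply]

theorem IsBarycentricSystem.isPiecewiseLinear_toStdSimplex (hΦ : IsBarycentricSystem Ω B Φ)
    (hC : ∀ σ ∈ Ω, (Φ σ).support ⊆ C) (hΩ : Convex ℝ Ω) (hCΩ : (C : Set E) ⊆ Ω) :
    IsPiecewiseLinear fun σ : Ω => (hΦ.toStdSimplex hC σ : C → ℝ) := by
  -- The cells are the hulls of the supports, finite in number because the supports are subsets of
  -- `C`.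
  refine ⟨(fun σ => convexHull ℝ ((Φ σ).support : Set E)) '' Ω, ?_, ?_, ?_, ?_⟩
  · refine (C.powerset.finite_toSet.image fun s : Finset E => convexHull ℝ (s : Set E)).subset ?_
    rintro _ ⟨σ, hσ, rfl⟩
    exact ⟨(Φ σ).support, by simpa using hC σ hσ, rfl⟩
  · rintro _ ⟨σ, -, rfl⟩
    exact ⟨_, Finset.finite_toSet _, rfl⟩
  · refine Set.Subset.antisymm (Set.sUnion_subset ?_) fun σ hσ => ?_
    · rintro _ ⟨σ, hσ, rfl⟩
      exact convexHull_min (fun b hb => hCΩ (hC σ hσ hb)) hΩ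
    · exact ⟨_, ⟨σ, hσ, rfl⟩, Finset.mem_convexHull'.2 ⟨Φ σ, fun b _ => hΦ.nonneg σ hσ b,
        hΦ.sum_eq_one hσ subset_rfl, hΦ.sum_smul_eq hσ subset_rfl⟩⟩
  · rintro _ ⟨σ, hσ, rfl⟩
    obtain ⟨L, hL⟩ := hΦ.exists_affineMap hσ
    refine ⟨(LinearMap.pi fun b : C => Finsupp.lapply (b : E) ∘ₗ L).toAffineMap.comp
      ((AffineMap.id ℝ E).prod (AffineMap.const ℝ E (1 : ℝ))), fun y hy => ?_⟩
    funext b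
    exact congrArg (fun w => w (b : E)) (hL y hy)

theorem IsBarycentricSystem.exists_lipschitzWith_toStdSimplex (hΦ : IsBarycentricSystem Ω B Φ)
    (hC : ∀ σ ∈ Ω, (Φ σ).support ⊆ C) : ∃ κ : ℝ≥0, LipschitzWith κ fun σ : Ω =>
      (WithLp.toLp 2 (hΦ.toStdSimplex hC σ : C → ℝ) : EuclideanSpace ℝ C) := by
  choose K hK using hΦ.lipschitz
  have h1 : LipschitzWith (∑ b : C, K b) fun σ : Ω => (hΦ.toStdSimplex hC σ : C → ℝ) := by
    refine LipschitzWith.of_dist_le_mul fun x y => (dist_pi_le_iff (by positivity)).2 fun b => ?_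
    refine ((hK b).dist_le_mul x y).trans ?_
    refine mul_le_mul_of_nonneg_right ?_ dist_nonneg
    exact_mod_cast Finset.single_le_sum (f := fun b : C => K b) (fun _ _ => zero_le)
      (Finset.mem_univ b)
  exact ⟨_, (PiLp.lipschitzWith_toLp 2 fun _ : C => ℝ).comp h1⟩

end Restriction

/-! ### Application to the game -/

namespace PartialMonitoringGame

variable {I J S : Type*} [Fintype J] [Fintype S] {d : ℕ}

/-- The signal map as a linear map on `ℝ^J`. -/
noncomputable def signalLinear (G : PartialMonitoringGame I J S d) :
    (J → ℝ) →ₗ[ℝ] EuclideanSpace ℝ (I × S) where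
  toFun q := WithLp.toLp 2 fun x => ∑ j, q j * (G.H x.1 j : S → ℝ) x.2
  map_add' q q' := by
    ext x
    simp [add_mul, Finset.sum_add_distrib]
  map_smul' t q := by
    ext x
    simp [mul_assoc, Finset.mul_sum]

/-- The payoff of a mixed action of the first player as a linear map on `ℝ^J`. -/
noncomputable def payoffLinear [Fintype I] (G : PartialMonitoringGame I J S d)
    (p : stdSimplex ℝ I) :
    (J → ℝ) →ₗ[ℝ] EuclideanSpace ℝ (Fin d) where
  toFun q := ∑ i, ∑ j, ((p : I → ℝ) i * q j) • G.r i j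
  map_add' q q' := by
    simp only [Pi.add_apply, mul_add, add_smul, Finset.sum_add_distrib]
  map_smul' t q := by
    simp only [Pi.smul_apply, smul_eq_mul, Finset.smul_sum, smul_smul, RingHom.id_apply,
      mul_left_comm]

theorem feasible_eq_image (G : PartialMonitoringGame I J S d) :
    G.feasible = G.signalLinear '' stdSimplex ℝ J := by
  ext σ
  constructor
  · rintro ⟨q, rfl⟩
    exact ⟨q, q.2, rfl⟩
  · rintro ⟨q, hq, rfl⟩
    exact ⟨⟨q, hq⟩, rfl⟩

theorem setPayoff_eq_image [Fintype I] (G : PartialMonitoringGame I J S d)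
    (p : stdSimplex ℝ I) (σ : EuclideanSpace ℝ (I × S)) :
    G.setPayoff p σ = G.payoffLinear p '' simplexFiber G.signalLinear σ := by
  ext x
  constructor
  · rintro ⟨q, hq, rfl⟩
    exact ⟨q, ⟨q.2, hq⟩, rfl⟩
  · rintro ⟨q, ⟨hq, hqσ⟩, rfl⟩
    exact ⟨⟨q, hq⟩, hqσ, rfl⟩

theorem convex_feasible (G : PartialMonitoringGame I J S d) : Convex ℝ G.feasible := by
  rw [feasible_eq_image]
  exact (convex_stdSimplex ℝ J).linear_image _

theorem setPayoff_nonempty [Fintype I] (G : PartialMonitoringGame I J S d)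
    (p : stdSimplex ℝ I) {σ : EuclideanSpace ℝ (I × S)} (hσ : σ ∈ G.feasible) :
    (G.setPayoff p σ).Nonempty := by
  obtain ⟨q, hq⟩ := hσ
  exact ⟨_, q, hq, rfl⟩

theorem nonneg_of_mem_feasible (G : PartialMonitoringGame I J S d)
    {σ : EuclideanSpace ℝ (I × S)} (hσ : σ ∈ G.feasible) (x : I × S) : 0 ≤ σ x := by
  obtain ⟨q, rfl⟩ := hσ
  exact Finset.sum_nonneg fun j _ => mul_nonneg (q.2.1 j) ((G.H x.1 j).2.1 x.2)

theorem sum_eq_card_of_mem_feasible [Fintype I] (G : PartialMonitoringGame I J S d)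
    {σ : EuclideanSpace ℝ (I × S)} (hσ : σ ∈ G.feasible) : ∑ x, σ x = Fintype.card I := by
  obtain ⟨q, rfl⟩ := hσ
  have h : ∀ i, ∑ s, ∑ j, (q : J → ℝ) j * (G.H i j : S → ℝ) s = 1 := by
    intro i
    rw [Finset.sum_comm]
    have h2 : ∀ j, ∑ s, (q : J → ℝ) j * (G.H i j : S → ℝ) s = (q : J → ℝ) j := by
      intro j
      have h3 : ∑ s, (G.H i j : S → ℝ) s = 1 := (G.H i j).2.2
      rw [← Finset.mul_sum, h3, mul_one]
    simp only [h2]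
    exact q.2.2
  simp only [signalMap, Fintype.sum_prod_type, h]
  simp

theorem sum_smul_setPayoff_subset [Fintype I] (G : PartialMonitoringGame I J S d)
    (p : stdSimplex ℝ I) {B : Finset (EuclideanSpace ℝ (I × S))} (w : stdSimplex ℝ B)
    {σ : EuclideanSpace ℝ (I × S)}
    (hσ : ∑ b : B, (w : B → ℝ) b • (b : EuclideanSpace ℝ (I × S)) = σ) :
    ∑ b : B, (w : B → ℝ) b • G.setPayoff p b ⊆ G.setPayoff p σ := by
  intro x hx
  obtain ⟨g, hg, rfl⟩ := (Set.mem_fintype_sum _ _).1 hx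
  choose y hy hyg using fun b => Set.mem_smul_set.1 (hg b)
  simp only [setPayoff_eq_image] at hy ⊢
  choose q hq hqy using hy
  refine ⟨∑ b : B, (w : B → ℝ) b • q b, ⟨?_, ?_⟩, ?_⟩
  · exact (convex_stdSimplex ℝ J).sum_mem (fun b _ => w.2.1 b) w.2.2 fun b _ => (hq b).1
  · rw [← hσ, map_sum]
    exact Finset.sum_congr rfl fun b _ => by rw [map_smul, (hq b).2]
  · rw [map_sum]
    exact Finset.sum_congr rfl fun b _ => by rw [map_smul, hqy, hyg]

end PartialMonitoringGame

theorem mainTheorem9 {I J S : Type*} [Fintype I] [Fintype J] [Fintype S] {d : ℕ}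
    (G : PartialMonitoringGame I J S d) :
    ∃ (B : Finset (EuclideanSpace ℝ (I × S))) (Φ : G.feasible → stdSimplex ℝ B),
      (B : Set (EuclideanSpace ℝ (I × S))) ⊆ G.feasible ∧
      IsPiecewiseLinear (fun σ => (Φ σ : B → ℝ)) ∧
      Function.Injective Φ ∧
      (∀ (p : stdSimplex ℝ I) (σ : G.feasible),
        G.setPayoff p σ = ∑ b : B, (Φ σ : B → ℝ) b • G.setPayoff p b) ∧
      ∃ κ : ℝ≥0, LipschitzWith κ
        (fun σ => (WithLp.toLp 2 (Φ σ : B → ℝ) : EuclideanSpace ℝ B)) := by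
  classical
  -- Feasible vectors have coordinate sum `Fintype.card I`; the extra `1` keeps the size positive
  -- when `I` is empty.
  have h₀ := isBarycentricSystem_cornerCoordinates (M := Fintype.card I + 1) (by positivity)
    (fun σ hσ => G.nonneg_of_mem_feasible hσ)
    (fun σ hσ => (G.sum_eq_card_of_mem_feasible hσ).trans_le (by linarith))
  rw [G.feasible_eq_image] at h₀
  obtain ⟨B, Φ, hΦ, hL⟩ := exists_isBarycentricSystem_simplexFiber G.signalLinear h₀
  have hdec := fun σ q hq => hΦ.exists_decomposition hL (σ := σ) (q := q) hq
  have hne := fun σ hσ b hb => mem_image_stdSimplex_of_ne_zero hL (σ := σ) hσ (b := b) hb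
  rw [← G.feasible_eq_image] at hΦ hne
  -- The triangulation overshoots `F`, but vertices carrying mass of a feasible point are feasible,
  -- so the others can be discarded.
  have hC : ∀ σ ∈ G.feasible, (Φ σ).support ⊆ B.filter (· ∈ G.feasible) := fun σ hσ b hb =>
    Finset.mem_filter.2 ⟨hΦ.support_subset σ hb, hne σ hσ b (Finsupp.mem_support_iff.1 hb)⟩
  have hCF : ((B.filter (· ∈ G.feasible) : Finset _) : Set (EuclideanSpace ℝ (I × S))) ⊆
      G.feasible := fun b hb => (Finset.mem_filter.1 hb).2
  refine ⟨B.filter (· ∈ G.feasible), hΦ.toStdSimplex hC, hCF,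
    hΦ.isPiecewiseLinear_toStdSimplex hC G.convex_feasible hCF, hΦ.toStdSimplex_injective hC,
    fun p σ => Set.Subset.antisymm ?_ ?_, hΦ.exists_lipschitzWith_toStdSimplex hC⟩
  · intro y hy
    rw [G.setPayoff_eq_image] at hy
    obtain ⟨q, hq, rfl⟩ := hy
    obtain ⟨x, hx, hxq⟩ := hdec σ q hq
    have hsum : ∑ b : ↥(B.filter (· ∈ G.feasible)), Φ σ b • x b = q := by
      rw [Finset.sum_coe_sort (B.filter (· ∈ G.feasible)) fun b => Φ σ b • x b, ← hxq]
      refine Finset.sum_subset (Finset.filter_subset _ _) fun b _ hb => ?_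
      have : Φ σ b = 0 := by
        by_contra h
        exact hb (hC σ σ.2 (Finsupp.mem_support_iff.2 h))
      rw [this, zero_smul]
    rw [← hsum, map_sum]
    refine (Set.mem_fintype_sum _ _).2 ⟨_, fun b => ?_, rfl⟩
    rw [map_smul, hΦ.toStdSimplex_apply]
    by_cases hb : Φ σ b = 0
    -- Zero times a set is `{0}` only if the set is nonempty, which is why every retained vertex
    -- must be feasible.
    · rw [hb, zero_smul, Set.zero_smul_set (G.setPayoff_nonempty p (hCF b.2))]
      rfl
    · refine Set.smul_mem_smul_set ?_
      rw [G.setPayoff_eq_image]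
      exact ⟨_, hx b hb, rfl⟩
  · refine G.sum_smul_setPayoff_subset p _ ?_
    exact (Finset.sum_coe_sort (B.filter (· ∈ G.feasible)) fun b => Φ σ b • b).trans
      (hΦ.sum_smul_eq σ.2 (hC σ σ.2))
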